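/- Let $\mu,\nu$ be Borel probability measures on $\mathbb{R}^D$ with finite second moments, and let $c(x,y)=\tfrac12\|x-y\|^2$. Assume that some minimizer of $\pi\mapsto\int c\,d\pi$ over the couplings of $\mu$ and $\nu$ is deterministic, i.e. of the form $[\mathrm{id},S]_{\#}\mu$ with $S:\mathbb{R}^D\to\mathbb{R}^D$ measurable. Let $T^*$ be an optimal transport map from $\mu$ to $\nu$, i.e. a minimizer of $\int c(x,T(x))\,d\mu(x)$ over all measurable $T:\mathbb{R}^D\to\mathbb{R}^D$ with $T_{\#}\mu=\nu$. For $v:\mathbb{R}^D\to\mathbb{R}$ put $v^c(x)=\inf_{y}\{c(x,y)-v(y)\}\in[-\infty,\infty)$. Call $\psi^*:\mathbb{R}^D\to\mathbb{R}$ an optimal potential if $\psi^*(y)=\tfrac12\|y\|^2-v^*(y)$ for all $y$, where $v^*\in L^1(\nu)$ attains the supremum of $$\int v^c\,d\mu+\int v\,d\nu\in[-\infty,\infty)$$ over all $v:\mathbb{R}^D\to\mathbb{R}$ in $L^1(\nu)$. Then for every optimal potential $\psi^*$ the function $x\mapsto\langle x,T^*(x)\rangle-\psi^*(T^*(x))$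 is $\mu$-integrable, and $$T^*\in\operatorname*{arg\,sup}_{T:\mathbb{R}^D\to\mathbb{R}^D}\int\{\langle x,T(x)\rangle-\psi^*(T(x))\}\,d\mu(x),$$ where the integral, with values in the extended reals, is the integral of the positive part minus the integral of the negative part (for a non-measurable nonnegative function, the lower integral is meant). Moreover, for $\mu$-almost every $x$, $T^*(x)$ attains the convex conjugate of $\psi^*$ at $x$: $$\langle x,T^*(x)\rangle-\psi^*(T^*(x))=\sup_{y\in\mathbb{R}^D}\{\langle x,y\rangle-\psi^*(y)\}.$$ -/

import Mathlib

open MeasureTheory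
open scoped ENNReal RealInnerProductSpace

noncomputable section

namespace OT

/-- The space `ℝ^D` with its Euclidean norm and inner product. -/
abbrev Sp (D : ℕ) : Type := EuclideanSpace ℝ (Fin D)

variable {D : ℕ}

/-- The quadratic ground cost `c(x, y) = ‖x - y‖² / 2`. -/
def quadCost (x y : Sp D) : ℝ := ‖x - y‖ ^ 2 / 2

/-- Finite second moment. -/
def FiniteSecondMoment (μ : Measure (Sp D)) : Prop := Integrable (fun x => ‖x‖ ^ 2) μ

/-- The Lebesgue integral, in the extended reals, of an extended-real-valued function:
the integral of the positive part minus the integral of the negative part. In particular it is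
`⊥` when the positive part has a finite integral and the negative part has not. -/
def extIntegral (μ : Measure (Sp D)) (f : Sp D → EReal) : EReal :=
  ((∫⁻ x, (f x).toENNReal ∂μ : ℝ≥0∞) : EReal) - ((∫⁻ x, (-f x).toENNReal ∂μ : ℝ≥0∞) : EReal)

/-! ### Primal problems -/

/-- The cost of a transport map `T` (the cost function is nonnegative). -/
def mapCost (μ : Measure (Sp D)) (T : Sp D → Sp D) : ℝ≥0∞ :=
  ∫⁻ x, ENNReal.ofReal (quadCost x (T x)) ∂μ

/-- `T` is measurable and pushes `μ` forward to `ν`. -/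
def IsTransportMap (μ ν : Measure (Sp D)) (T : Sp D → Sp D) : Prop :=
  Measurable T ∧ μ.map T = ν

/-- Optimal transport map: a minimizer in Monge's problem. -/
def IsOTMap (μ ν : Measure (Sp D)) (T : Sp D → Sp D) : Prop :=
  IsTransportMap μ ν T ∧ ∀ S : Sp D → Sp D, IsTransportMap μ ν S → mapCost μ T ≤ mapCost μ S

/-- Couplings: measures on the product whose marginals are `μ` and `ν`. -/
def IsCoupling (μ ν : Measure (Sp D)) (π : Measure (Sp D × Sp D)) : Prop :=
  π.fst = μ ∧ π.snd = ν

/-- The cost of a transport plan. -/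
def planCost (π : Measure (Sp D × Sp D)) : ℝ≥0∞ :=
  ∫⁻ p, ENNReal.ofReal (quadCost p.1 p.2) ∂π

/-- Optimal transport plan: a minimizer in Kantorovich's problem. -/
def IsOTPlan (μ ν : Measure (Sp D)) (π : Measure (Sp D × Sp D)) : Prop :=
  IsCoupling μ ν π ∧ ∀ π' : Measure (Sp D × Sp D), IsCoupling μ ν π' → planCost π ≤ planCost π'

/-- The plan `[id, T]_# μ` induced by a map `T`. -/
def mapPlan (μ : Measure (Sp D)) (T : Sp D → Sp D) : Measure (Sp D × Sp D) :=
  μ.map (fun x => (x, T x))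

/-! ### Dual problem -/

/-- The `c`-transform `v^c(x) = inf_y (c(x, y) - v(y))`, with values in `[-∞, ∞)`. -/
def cTransform (v : Sp D → ℝ) (x : Sp D) : EReal :=
  ⨅ y : Sp D, ((quadCost x y - v y : ℝ) : EReal)

/-- The dual objective `∫ v^c dμ + ∫ v dν`, with values in `[-∞, ∞)` for `v ∈ L¹(ν)`. -/
def dualObjective (μ ν : Measure (Sp D)) (v : Sp D → ℝ) : EReal :=
  extIntegral μ (cTransform v) + ((∫ y, v y ∂ν : ℝ) : EReal)

/-- `v ∈ L¹(ν)` attains the supremum of the dual objective over `L¹(ν)`. -/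
def IsDualMaximizer (μ ν : Measure (Sp D)) (v : Sp D → ℝ) : Prop :=
  Integrable v ν ∧
    ∀ w : Sp D → ℝ, Integrable w ν → dualObjective μ ν w ≤ dualObjective μ ν v

/-- `ψ = ‖·‖² / 2 - v` for a solution `v` of the dual problem. -/
def IsOptimalPotential (μ ν : Measure (Sp D)) (ψ : Sp D → ℝ) : Prop :=
  ∃ v : Sp D → ℝ, IsDualMaximizer μ ν v ∧ ∀ y, ψ y = ‖y‖ ^ 2 / 2 - v y

/-- The convex conjugate `x ↦ sup_y (⟨x, y⟩ - ψ(y))`, with values in `(-∞, ∞]`. -/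
def conjugate (ψ : Sp D → ℝ) (x : Sp D) : EReal :=
  ⨆ y : Sp D, ((⟪x, y⟫ - ψ y : ℝ) : EReal)

/-- The functional `T ↦ ∫ (⟨x, T x⟩ - ψ(T x)) dμ(x)`. -/
def mapObjective (μ : Measure (Sp D)) (ψ : Sp D → ℝ) (T : Sp D → Sp D) : EReal :=
  extIntegral μ (fun x => ((⟪x, T x⟫ - ψ (T x) : ℝ) : EReal))

end OT

end

open Filter Topology
open scoped CompactlySupported

namespace OT

/-! Expanding the square gives `⟪x, y⟫ - ψ y = ‖x‖²/2 - (c(x, y) - v y)`, so the last claim says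
that the infimum defining `v^c(x)` is attained at `T* x` for almost every `x`; the other two claims
then follow. Always `v^c(x) ≤ c(x, T* x) - v(T* x)`, and equality almost everywhere follows once the
integrals agree, that is, once the cost of `T*` is at most the dual value
(`IsDualMaximizer.cTransform_ae_eq`).

This is the hard half of Kantorovich duality. The functional `splitInf` is sublinear on functions of
quadratic growth, and Hahn–Banach yields a linear `L` below it that is tight at `-c`. Such an `L` is
positive, has marginals `μ` and `ν`, and its value at `c` is the dual value
(`exists_coupling_functional`). Riesz–Markov represents `L` on compactly supported functions by a
measure `π`. Tightness of the marginals makes `π` a coupling, and Fatou bounds its cost by `L c`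
(`exists_isCoupling_planCost_le`). As some optimal plan is induced by a map, `T*` costs no more than
`π`. -/

/-- Hahn–Banach: a sublinear function on a real vector space is supported at each point by a
linear functional. -/
theorem exists_linear_le_sublinear {E : Type*} [AddCommGroup E] [Module ℝ E] (N : E → ℝ)
    (N_hom : ∀ c : ℝ, 0 < c → ∀ x, N (c • x) = c * N x)
    (N_add : ∀ x y, N (x + y) ≤ N x + N y) (x₀ : E) :
    ∃ L : E →ₗ[ℝ] ℝ, L x₀ = N x₀ ∧ ∀ x, L x ≤ N x := by
  have N_zero : N 0 = 0 := by
    have := N_hom 2 (by norm_num) 0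
    rw [smul_zero] at this
    linarith
  -- Needed for `s • x₀ ↦ s * N x₀` to be well defined when `x₀ = 0`.
  have H : ∀ c : ℝ, c • x₀ = 0 → (RingHom.id ℝ c) • N x₀ = 0 := by
    intro c hc
    rcases smul_eq_zero.1 hc with h | h
    · simp [h]
    · simp [h, N_zero]
  obtain ⟨L, hL, hLN⟩ := exists_extension_of_le_sublinear
    (LinearPMap.mkSpanSingleton' x₀ (N x₀) H) N N_hom N_add (by
      rintro ⟨x, hx⟩
      obtain ⟨s, rfl⟩ := Submodule.mem_span_singleton.1 hx
      rw [LinearPMap.mkSpanSingleton'_apply]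
      simp only [RingHom.id_apply, smul_eq_mul]
      rcases lt_trichotomy s 0 with hs | rfl | hs
      · have h1 := N_hom (-s) (by linarith) x₀
        have h2 := N_add (s • x₀) ((-s) • x₀)
        rw [← add_smul, add_neg_cancel, zero_smul, N_zero] at h2
        linarith
      · simp [N_zero]
      · exact (N_hom s hs x₀).ge)
  refine ⟨L, ?_, hLN⟩
  have := hL ⟨x₀, Submodule.mem_span_singleton_self x₀⟩
  exact this.trans (LinearPMap.mkSpanSingleton'_apply_self _ _ _ _)

/-! ### Functions of quadratic growth and their split upper bounds -/

/-- Real functions of at most quadratic growth on the product space. -/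
def quadGrowth (D : ℕ) : Submodule ℝ (Sp D × Sp D → ℝ) where
  carrier := {h | ∃ K : ℝ, ∀ p, |h p| ≤ K * (1 + ‖p.1‖ ^ 2 + ‖p.2‖ ^ 2)}
  add_mem' := by
    rintro f g ⟨K, hK⟩ ⟨M, hM⟩
    refine ⟨K + M, fun p => (abs_add_le _ _).trans ?_⟩
    have := hK p
    have := hM p
    linarith
  zero_mem' := ⟨0, fun p => by simp⟩
  smul_mem' := by
    rintro c f ⟨K, hK⟩
    refine ⟨|c| * K, fun p => ?_⟩
    rw [Pi.smul_apply, smul_eq_mul, abs_mul, mul_assoc]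
    exact mul_le_mul_of_nonneg_left (hK p) (abs_nonneg c)

theorem mem_quadGrowth_of_abs_le {D : ℕ} {h : Sp D × Sp D → ℝ} (M : ℝ) (hM : ∀ p, |h p| ≤ M) :
    h ∈ quadGrowth D := by
  refine ⟨M, fun p => (hM p).trans ?_⟩
  have h0 : 0 ≤ M := (abs_nonneg _).trans (hM p)
  nlinarith [sq_nonneg ‖p.1‖, sq_nonneg ‖p.2‖, mul_nonneg h0 (sq_nonneg ‖p.1‖),
    mul_nonneg h0 (sq_nonneg ‖p.2‖)]

theorem quadCost_nonneg {D : ℕ} (x y : Sp D) : 0 ≤ quadCost x y := by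
  unfold quadCost
  positivity

theorem quadCost_le {D : ℕ} (x y : Sp D) : quadCost x y ≤ ‖x‖ ^ 2 + ‖y‖ ^ 2 := by
  unfold quadCost
  have h := norm_sub_le x y
  nlinarith [norm_nonneg (x - y), norm_nonneg x, norm_nonneg y, sq_nonneg (‖x‖ - ‖y‖)]

theorem quadCost_mem_quadGrowth (D : ℕ) : (fun p : Sp D × Sp D => quadCost p.1 p.2) ∈ quadGrowth D :=
  ⟨1, fun p => by
    rw [abs_of_nonneg (quadCost_nonneg _ _)]
    linarith [quadCost_le p.1 p.2]⟩

/-- A positive linear functional whose values on the functions `a ⊕ b` are those of a coupling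
of `μ` and `ν`. -/
structure IsCouplingFunctional {D : ℕ} (μ ν : Measure (Sp D)) (L : quadGrowth D →ₗ[ℝ] ℝ) :
    Prop where
  nonneg : ∀ h, (∀ p, 0 ≤ h.1 p) → 0 ≤ L h
  apply_add : ∀ h (a b : Sp D → ℝ), Integrable a μ → Integrable b ν →
    (∀ x y, h.1 (x, y) = a x + b y) → L h = ∫ x, a x ∂μ + ∫ y, b y ∂ν

/-- The values `∫ a dμ + ∫ b dν` over the integrable `a`, `b` with `h ≤ a ⊕ b`. -/
def splitBounds {D : ℕ} (μ ν : Measure (Sp D)) (h : Sp D × Sp D → ℝ) : Set ℝ :=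
  {r | ∃ a b : Sp D → ℝ, Integrable a μ ∧ Integrable b ν ∧ (∀ x y, h (x, y) ≤ a x + b y) ∧
    r = ∫ x, a x ∂μ + ∫ y, b y ∂ν}

/-- The infimum of `∫ a dμ + ∫ b dν` over the integrable `a`, `b` with `h ≤ a ⊕ b`. -/
noncomputable def splitInf {D : ℕ} (μ ν : Measure (Sp D)) (h : Sp D × Sp D → ℝ) : ℝ :=
  sInf (splitBounds μ ν h)

theorem exists_split_bounds {D : ℕ} {μ ν : Measure (Sp D)} [IsFiniteMeasure μ]
    (hμ : FiniteSecondMoment μ) (hν : FiniteSecondMoment ν) {h : Sp D × Sp D → ℝ} (hh : h ∈ quadGrowth D) :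
    ∃ a b : Sp D → ℝ, Integrable a μ ∧ Integrable b ν ∧ ∀ x y, |h (x, y)| ≤ a x + b y := by
  obtain ⟨K, hK⟩ := hh
  refine ⟨fun x => K * (1 + ‖x‖ ^ 2), fun y => K * ‖y‖ ^ 2,
    ((integrable_const 1).add hμ).const_mul K, hν.const_mul K, fun x y => ?_⟩
  have := hK (x, y)
  dsimp only at this ⊢
  linarith

theorem splitBounds_nonempty {D : ℕ} {μ ν : Measure (Sp D)} [IsFiniteMeasure μ]
    (hμ : FiniteSecondMoment μ) (hν : FiniteSecondMoment ν) {h : Sp D × Sp D → ℝ} (hh : h ∈ quadGrowth D) : (splitBounds μ ν h).Nonempty := by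
  obtain ⟨a, b, ha, hb, hab⟩ := exists_split_bounds hμ hν hh
  exact ⟨_, a, b, ha, hb, fun x y => (le_abs_self _).trans (hab x y), rfl⟩

/-! ### Sublinearity of `splitInf` and the Hahn–Banach functional -/

section SplitInf

variable {D : ℕ} {μ ν : Measure (Sp D)} [IsProbabilityMeasure μ] [IsProbabilityMeasure ν]

/-- From `a₀ x - a x ≤ b y - b₀ y`, integrate first in `x` and then in `y`. No measurability of `h`
is involved. -/
theorem integral_add_integral_le_of_mem_splitBounds {h : Sp D × Sp D → ℝ} {a₀ b₀ : Sp D → ℝ}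
    (ha₀ : Integrable a₀ μ) (hb₀ : Integrable b₀ ν) (h₀ : ∀ x y, a₀ x + b₀ y ≤ h (x, y))
    {r : ℝ} (hr : r ∈ splitBounds μ ν h) : ∫ x, a₀ x ∂μ + ∫ y, b₀ y ∂ν ≤ r := by
  obtain ⟨a, b, ha, hb, hab, rfl⟩ := hr
  have key : ∀ y, ∫ x, a₀ x ∂μ - ∫ x, a x ∂μ ≤ b y - b₀ y := by
    intro y
    rw [← integral_sub ha₀ ha]
    have := integral_mono (ha₀.sub ha) (integrable_const (b y - b₀ y)) (μ := μ) (fun x => by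
      have h1 := h₀ x y
      have h2 := hab x y
      simp only [Pi.sub_apply]
      linarith)
    simpa using this
  have := integral_mono (integrable_const (∫ x, a₀ x ∂μ - ∫ x, a x ∂μ)) (hb.sub hb₀) key
  simp only [integral_const, probReal_univ, one_smul] at this
  have h3 : ∫ y, (b - b₀) y ∂ν = ∫ y, b y ∂ν - ∫ y, b₀ y ∂ν := integral_sub hb hb₀
  linarith

theorem splitBounds_bddBelow (hμ : FiniteSecondMoment μ) (hν : FiniteSecondMoment ν)
    {h : Sp D × Sp D → ℝ} (hh : h ∈ quadGrowth D) : BddBelow (splitBounds μ ν h) := by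
  obtain ⟨a, b, ha, hb, hab⟩ := exists_split_bounds hμ hν hh
  refine ⟨_, fun r hr => integral_add_integral_le_of_mem_splitBounds ha.neg hb.neg ?_ hr⟩
  intro x y
  have := (neg_abs_le (h (x, y)))
  have := hab x y
  simp only [Pi.neg_apply]
  linarith

theorem splitInf_le (hμ : FiniteSecondMoment μ) (hν : FiniteSecondMoment ν)
    {h : Sp D × Sp D → ℝ} (hh : h ∈ quadGrowth D) {a b : Sp D → ℝ} (ha : Integrable a μ)
    (hb : Integrable b ν) (hab : ∀ x y, h (x, y) ≤ a x + b y) :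
    splitInf μ ν h ≤ ∫ x, a x ∂μ + ∫ y, b y ∂ν :=
  csInf_le (splitBounds_bddBelow hμ hν hh) ⟨a, b, ha, hb, hab, rfl⟩

theorem splitInf_add_le (hμ : FiniteSecondMoment μ) (hν : FiniteSecondMoment ν)
    {g h : Sp D × Sp D → ℝ} (hg : g ∈ quadGrowth D) (hh : h ∈ quadGrowth D) :
    splitInf μ ν (g + h) ≤ splitInf μ ν g + splitInf μ ν h := by
  rw [← sub_le_iff_le_add]
  refine le_csInf (splitBounds_nonempty hμ hν hg) ?_
  rintro _ ⟨a, b, ha, hb, hab, rfl⟩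
  rw [sub_le_iff_le_add, ← sub_le_iff_le_add']
  refine le_csInf (splitBounds_nonempty hμ hν hh) ?_
  rintro _ ⟨a', b', ha', hb', hab', rfl⟩
  have := splitInf_le hμ hν (add_mem hg hh) (ha.add ha') (hb.add hb') (fun x y => by
    have := hab x y
    have := hab' x y
    simp only [Pi.add_apply]
    linarith)
  have h1 : ∫ x, (a + a') x ∂μ = _ := integral_add ha ha'
  have h2 : ∫ x, (b + b') x ∂ν = _ := integral_add hb hb'
  linarith

theorem splitInf_smul_le (hμ : FiniteSecondMoment μ) (hν : FiniteSecondMoment ν)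
    {h : Sp D × Sp D → ℝ} (hh : h ∈ quadGrowth D) {c : ℝ} (hc : 0 < c) :
    splitInf μ ν (c • h) ≤ c * splitInf μ ν h := by
  rw [← div_le_iff₀' hc]
  refine le_csInf (splitBounds_nonempty hμ hν hh) ?_
  rintro _ ⟨a, b, ha, hb, hab, rfl⟩
  rw [div_le_iff₀' hc, mul_add, ← integral_const_mul, ← integral_const_mul]
  refine splitInf_le hμ hν (Submodule.smul_mem _ c hh) (ha.const_mul c) (hb.const_mul c) ?_
  intro x y
  rw [← mul_add, Pi.smul_apply, smul_eq_mul]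
  exact mul_le_mul_of_nonneg_left (hab x y) hc.le

theorem splitInf_smul (hμ : FiniteSecondMoment μ) (hν : FiniteSecondMoment ν)
    {h : Sp D × Sp D → ℝ} (hh : h ∈ quadGrowth D) {c : ℝ} (hc : 0 < c) :
    splitInf μ ν (c • h) = c * splitInf μ ν h := by
  refine le_antisymm (splitInf_smul_le hμ hν hh hc) ?_
  have := splitInf_smul_le hμ hν (Submodule.smul_mem _ c hh) (inv_pos.2 hc)
  rwa [inv_smul_smul₀ hc.ne', ← div_eq_inv_mul, le_div_iff₀' hc] at this

/-- A positive linear functional with marginals `μ` and `ν`, extremal for the quadratic cost. -/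
theorem exists_coupling_functional (hμ : FiniteSecondMoment μ) (hν : FiniteSecondMoment ν) :
    ∃ L : quadGrowth D →ₗ[ℝ] ℝ, IsCouplingFunctional μ ν L ∧
      L ⟨_, quadCost_mem_quadGrowth D⟩ = -splitInf μ ν (fun p => -quadCost p.1 p.2) := by
  obtain ⟨L, hL, hLN⟩ := exists_linear_le_sublinear (fun h : quadGrowth D => splitInf μ ν h.1)
    (fun c hc h => splitInf_smul hμ hν h.2 hc) (fun g h => splitInf_add_le hμ hν g.2 h.2)
    -- Tightness is imposed at `-c` rather than `c`: upper bounds `a ⊕ b` of `-c` are, up to sign,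
    -- the competitors of the dual problem.
    (-⟨_, quadCost_mem_quadGrowth D⟩)
  have hle : ∀ h (a b : Sp D → ℝ), Integrable a μ → Integrable b ν →
      (∀ x y, h.1 (x, y) ≤ a x + b y) → L h ≤ ∫ x, a x ∂μ + ∫ y, b y ∂ν :=
    fun h a b ha hb hab => (hLN h).trans (splitInf_le hμ hν h.2 ha hb hab)
  refine ⟨L, ⟨fun h hh => ?_, fun h a b ha hb hab => le_antisymm
    (hle h a b ha hb fun x y => (hab x y).le) ?_⟩, ?_⟩
  · have := hle (-h) 0 0 (integrable_zero _ _ _) (integrable_zero _ _ _) (fun x y => by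
      simpa using hh (x, y))
    simpa using this
  · have := hle (-h) (-a) (-b) ha.neg hb.neg (fun x y => by
      have := hab x y
      simp only [Submodule.coe_neg, Pi.neg_apply]
      linarith)
    simp only [map_neg, Pi.neg_apply, integral_neg] at this
    linarith
  · rw [map_neg] at hL
    rw [← neg_eq_iff_eq_neg, hL]
    rfl

end SplitInf

/-! ### Cutoffs -/

/-- A continuous function with compact support that is `1` on the ball of radius `n`. -/
noncomputable def cutoff {D : ℕ} (n : ℕ) (x : Sp D) : ℝ := max 0 (min 1 (n + 1 - ‖x‖))

section Cutoff

variable {D : ℕ}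

theorem continuous_cutoff (n : ℕ) : Continuous (cutoff n : Sp D → ℝ) := by
  unfold cutoff
  fun_prop

theorem cutoff_nonneg (n : ℕ) (x : Sp D) : 0 ≤ cutoff n x := le_max_left _ _

theorem cutoff_le_one (n : ℕ) (x : Sp D) : cutoff n x ≤ 1 :=
  max_le zero_le_one (min_le_left _ _)

theorem cutoff_eq_one {n : ℕ} {x : Sp D} (h : ‖x‖ ≤ n) : cutoff n x = 1 := by
  unfold cutoff
  rw [min_eq_left (by linarith), max_eq_right zero_le_one]

theorem cutoff_eq_zero {n : ℕ} {x : Sp D} (h : (n : ℝ) + 1 ≤ ‖x‖) : cutoff n x = 0 := by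
  unfold cutoff
  exact max_eq_left ((min_le_right _ _).trans (by linarith))

theorem tendsto_cutoff (x : Sp D) : Tendsto (fun n => cutoff n x) atTop (𝓝 1) := by
  obtain ⟨m, hm⟩ := exists_nat_ge ‖x‖
  refine tendsto_const_nhds.congr' ?_
  filter_upwards [eventually_ge_atTop m] with n hn
  exact (cutoff_eq_one (hm.trans (by exact_mod_cast hn))).symm

theorem integrable_one_sub_cutoff (μ : Measure (Sp D)) [IsFiniteMeasure μ] (n : ℕ) :
    Integrable (fun x => 1 - cutoff n x) μ := by
  refine Integrable.of_bound (continuous_const.sub (continuous_cutoff n)).aestronglyMeasurable 1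
    (ae_of_all _ fun x => ?_)
  rw [Real.norm_eq_abs, abs_of_nonneg (by linarith [cutoff_le_one n x])]
  linarith [cutoff_nonneg n x]

theorem tendsto_integral_one_sub_cutoff (μ : Measure (Sp D)) [IsFiniteMeasure μ] :
    Tendsto (fun n => ∫ x, (1 - cutoff n x) ∂μ) atTop (𝓝 0) := by
  have := tendsto_integral_of_dominated_convergence (μ := μ) (F := fun n x => 1 - cutoff n x)
    (f := fun _ => (0 : ℝ)) (fun _ => (1 : ℝ))
    (fun n => (integrable_one_sub_cutoff μ n).aestronglyMeasurable) (integrable_const 1)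
    (fun n => ae_of_all _ fun x => by
      rw [Real.norm_eq_abs, abs_of_nonneg (by linarith [cutoff_le_one n x])]
      linarith [cutoff_nonneg n x])
    (ae_of_all _ fun x => by simpa using (tendsto_cutoff x).const_sub 1)
  simpa using this

/-- The product of a continuous function on the product space with the two cutoffs. -/
noncomputable def cutoffMul (n : ℕ) (g : C(Sp D × Sp D, ℝ)) : C_c(Sp D × Sp D, ℝ) where
  toFun p := g p * (cutoff n p.1 * cutoff n p.2)
  continuous_toFun := g.continuous.mul (((continuous_cutoff n).comp continuous_fst).mul
    ((continuous_cutoff n).comp continuous_snd))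
  hasCompactSupport' := by
    refine HasCompactSupport.intro ((isCompact_closedBall (0 : Sp D) (n + 1)).prod
      (isCompact_closedBall (0 : Sp D) (n + 1))) fun p hp => ?_
    rw [Set.mem_prod, not_and_or] at hp
    simp only [mem_closedBall_zero_iff, not_le] at hp
    rcases hp with h | h <;> simp [cutoff_eq_zero h.le]

theorem cutoffMul_apply (n : ℕ) (g : C(Sp D × Sp D, ℝ)) (p : Sp D × Sp D) :
    cutoffMul n g p = g p * (cutoff n p.1 * cutoff n p.2) := rfl

theorem abs_cutoffMul_le (n : ℕ) (g : C(Sp D × Sp D, ℝ)) (p : Sp D × Sp D) :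
    |cutoffMul n g p| ≤ |g p| := by
  rw [cutoffMul_apply, abs_mul,
    abs_of_nonneg (mul_nonneg (cutoff_nonneg n p.1) (cutoff_nonneg n p.2))]
  exact mul_le_of_le_one_right (abs_nonneg _)
    (mul_le_one₀ (cutoff_le_one _ _) (cutoff_nonneg _ _) (cutoff_le_one _ _))

theorem abs_sub_cutoffMul_le (n : ℕ) (g : C(Sp D × Sp D, ℝ)) (p : Sp D × Sp D) :
    |g p - cutoffMul n g p| ≤ |g p| * ((1 - cutoff n p.1) + (1 - cutoff n p.2)) := by
  have h1 := cutoff_nonneg n p.1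
  have h2 := cutoff_nonneg n p.2
  have h3 := cutoff_le_one n p.1
  have h4 := cutoff_le_one n p.2
  have e : g p - cutoffMul n g p = g p * (1 - cutoff n p.1 * cutoff n p.2) := by
    rw [cutoffMul_apply]
    ring
  rw [e, abs_mul]
  refine mul_le_mul_of_nonneg_left ?_ (abs_nonneg _)
  rw [abs_of_nonneg (by nlinarith)]
  nlinarith

theorem tendsto_cutoffMul (g : C(Sp D × Sp D, ℝ)) (p : Sp D × Sp D) :
    Tendsto (fun n => cutoffMul n g p) atTop (𝓝 (g p)) := by
  simpa [cutoffMul_apply] using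
    ((tendsto_cutoff p.1).mul (tendsto_cutoff p.2)).const_mul (g p)

end Cutoff

/-! ### From the functional to a coupling -/

/-- Compactly supported continuous functions have quadratic growth. -/
noncomputable def compactlySupportedToQuadGrowth (D : ℕ) :
    C_c(Sp D × Sp D, ℝ) →ₗ[ℝ] quadGrowth D where
  toFun f := ⟨f, by
    obtain ⟨M, hM⟩ := f.hasCompactSupport.exists_bound_of_continuous f.continuous
    exact mem_quadGrowth_of_abs_le M hM⟩
  map_add' _ _ := rfl
  map_smul' _ _ := rfl

namespace IsCouplingFunctional

variable {D : ℕ} {μ ν : Measure (Sp D)} {L : quadGrowth D →ₗ[ℝ] ℝ}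

theorem mono (hL : IsCouplingFunctional μ ν L) {g h : quadGrowth D} (hgh : ∀ p, g.1 p ≤ h.1 p) :
    L g ≤ L h := by
  have := hL.nonneg (h - g) (fun p => sub_nonneg.2 (hgh p))
  rwa [map_sub, sub_nonneg] at this

theorem abs_sub_le (hL : IsCouplingFunctional μ ν L) {g h k : quadGrowth D}
    (hgh : ∀ p, |g.1 p - h.1 p| ≤ k.1 p) : |L g - L h| ≤ L k := by
  rw [← map_sub, abs_le']
  refine ⟨hL.mono fun p => (le_abs_self _).trans (hgh p), ?_⟩
  rw [← map_neg]
  exact hL.mono fun p => (neg_le_abs _).trans (hgh p)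

/-- The cutoffs of `g` lie below `g` and converge to it, so positivity of `L` and Fatou's lemma
suffice. Only an inequality results, which is all that the cost requires. -/
theorem lintegral_le {π : Measure (Sp D × Sp D)} [IsFiniteMeasureOnCompacts π]
    (hL : IsCouplingFunctional μ ν L)
    (hπ : ∀ f : C_c(Sp D × Sp D, ℝ), ∫ p, f p ∂π = L (compactlySupportedToQuadGrowth D f))
    {g : Sp D × Sp D → ℝ} (hgc : Continuous g) (hg0 : ∀ p, 0 ≤ g p) (hg : g ∈ quadGrowth D) :
    ∫⁻ p, ENNReal.ofReal (g p) ∂π ≤ ENNReal.ofReal (L ⟨g, hg⟩) := by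
  have hbound : ∀ n : ℕ, ∫⁻ p, ENNReal.ofReal (cutoffMul n ⟨g, hgc⟩ p) ∂π ≤
      ENNReal.ofReal (L ⟨g, hg⟩) := by
    intro n
    rw [← ofReal_integral_eq_lintegral_ofReal (f := ⇑(cutoffMul n ⟨g, hgc⟩))
      (cutoffMul n ⟨g, hgc⟩).integrable
      (ae_of_all _ fun p => mul_nonneg (hg0 p)
        (mul_nonneg (cutoff_nonneg n p.1) (cutoff_nonneg n p.2))), hπ]
    refine ENNReal.ofReal_le_ofReal (hL.mono fun p => (le_abs_self _).trans ?_)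
    exact (abs_cutoffMul_le n ⟨g, hgc⟩ p).trans (abs_of_nonneg (hg0 p)).le
  have heq : ∀ p : Sp D × Sp D,
      liminf (fun n => ENNReal.ofReal (cutoffMul n ⟨g, hgc⟩ p)) atTop =
        ENNReal.ofReal (g p) := fun p =>
    ((ENNReal.continuous_ofReal.tendsto _).comp (tendsto_cutoffMul ⟨g, hgc⟩ p)).liminf_eq
  calc ∫⁻ p, ENNReal.ofReal (g p) ∂π
      = ∫⁻ p, liminf (fun n => ENNReal.ofReal (cutoffMul n ⟨g, hgc⟩ p)) atTop ∂π := by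
        simp only [heq]
    _ ≤ _ := lintegral_liminf_le fun n =>
        (cutoffMul n ⟨g, hgc⟩).continuous.measurable.ennreal_ofReal
    _ ≤ _ := liminf_le_of_le (by isBoundedDefault) fun b hb => by
        obtain ⟨n, hn⟩ := hb.exists
        exact hn.trans (hbound n)

/-- The measure representing the functional on compactly supported functions. -/
theorem exists_measure (hL : IsCouplingFunctional μ ν L) [IsProbabilityMeasure μ]
    [IsProbabilityMeasure ν] :
    ∃ π : Measure (Sp D × Sp D), IsFiniteMeasure π ∧
      ∀ f : C_c(Sp D × Sp D, ℝ), ∫ p, f p ∂π = L (compactlySupportedToQuadGrowth D f) := by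
  let Λ : C_c(Sp D × Sp D, ℝ) →ₚ[ℝ] ℝ :=
    PositiveLinearMap.mk₀ (L.comp (compactlySupportedToQuadGrowth D))
      (fun f hf => hL.nonneg _ hf)
  have hΛ : ∀ f, ∫ p, f p ∂(RealRMK.rieszMeasure Λ) = L (compactlySupportedToQuadGrowth D f) :=
    fun f => RealRMK.integral_rieszMeasure Λ f
  refine ⟨RealRMK.rieszMeasure Λ, ⟨?_⟩, hΛ⟩
  have one_mem : (fun _ => 1 : Sp D × Sp D → ℝ) ∈ quadGrowth D :=
    mem_quadGrowth_of_abs_le 1 (by simp)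
  have hone : L ⟨_, one_mem⟩ = 1 := by
    simpa using hL.apply_add ⟨_, one_mem⟩ (fun _ => 1) (fun _ => 0) (integrable_const _)
      (integrable_const _) (by simp)
  -- Finiteness of the total mass is the case `g = 1`.
  have := hL.lintegral_le hΛ continuous_const (fun _ => zero_le_one) one_mem
  rw [hone] at this
  simp only [ENNReal.ofReal_one, lintegral_const, one_mul] at this
  exact this.trans_lt ENNReal.one_lt_top

variable [IsProbabilityMeasure μ] [IsProbabilityMeasure ν] {π : Measure (Sp D × Sp D)}
  [IsFiniteMeasure π]

/-- The representation extends to bounded continuous functions, by tightness of `μ` and `ν`. -/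
theorem apply_eq_integral (hL : IsCouplingFunctional μ ν L)
    (hπ : ∀ f : C_c(Sp D × Sp D, ℝ), ∫ p, f p ∂π = L (compactlySupportedToQuadGrowth D f))
    (g : C(Sp D × Sp D, ℝ)) {M : ℝ} (hM : ∀ p, |g p| ≤ M) (hg : ⇑g ∈ quadGrowth D) :
    L ⟨g, hg⟩ = ∫ p, g p ∂π := by
  have h1 : Tendsto (fun n => ∫ p, cutoffMul n g p ∂π) atTop (𝓝 (∫ p, g p ∂π)) :=
    tendsto_integral_of_dominated_convergence (fun _ => M)
      (fun n => (cutoffMul n g).continuous.aestronglyMeasurable) (integrable_const M)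
      (fun n => ae_of_all _ fun p => (abs_cutoffMul_le n g p).trans (hM p))
      (ae_of_all _ fun p => tendsto_cutoffMul g p)
  refine tendsto_nhds_unique ?_ h1
  simp only [hπ]
  rw [tendsto_iff_norm_sub_tendsto_zero]
  have h2 : Tendsto (fun n => M * (∫ x, (1 - cutoff n x) ∂μ + ∫ y, (1 - cutoff n y) ∂ν)) atTop
      (𝓝 0) := by
    simpa using ((tendsto_integral_one_sub_cutoff μ).add
      (tendsto_integral_one_sub_cutoff ν)).const_mul M
  have hM0 : 0 ≤ M := (abs_nonneg _).trans (hM 0)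
  refine squeeze_zero (fun n => norm_nonneg _) (fun n => ?_) h2
  have hk : (fun p : Sp D × Sp D => M * ((1 - cutoff n p.1) + (1 - cutoff n p.2))) ∈
      quadGrowth D :=
    mem_quadGrowth_of_abs_le (M * 2) fun p => by
      have h1 := cutoff_nonneg n p.1
      have h2 := cutoff_nonneg n p.2
      have h3 := cutoff_le_one n p.1
      have h4 := cutoff_le_one n p.2
      rw [abs_mul, abs_of_nonneg hM0, abs_of_nonneg (by linarith)]
      exact mul_le_mul_of_nonneg_left (by linarith) hM0
  -- The error bound is of the form `a ⊕ b`, so `L` evaluates it through `μ` and `ν` alone, where it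
  -- tends to zero.
  have hLk := hL.apply_add ⟨_, hk⟩ (fun x => M * (1 - cutoff n x)) (fun y => M * (1 - cutoff n y))
    ((integrable_one_sub_cutoff μ n).const_mul M) ((integrable_one_sub_cutoff ν n).const_mul M)
    (fun x y => by simp only; ring)
  rw [integral_const_mul, integral_const_mul, ← mul_add] at hLk
  rw [Real.norm_eq_abs, abs_sub_comm, ← hLk]
  refine hL.abs_sub_le fun p => (abs_sub_cutoffMul_le n g p).trans ?_
  exact mul_le_mul_of_nonneg_right (hM p)
    (by linarith [cutoff_le_one n p.1, cutoff_le_one n p.2])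

theorem isCoupling (hL : IsCouplingFunctional μ ν L)
    (hπ : ∀ f : C_c(Sp D × Sp D, ℝ), ∫ p, f p ∂π = L (compactlySupportedToQuadGrowth D f)) :
    IsCoupling μ ν π := by
  constructor
  · refine ext_of_forall_integral_eq_of_IsFiniteMeasure fun f => ?_
    have hb : ∀ p : Sp D × Sp D, |f p.1| ≤ ‖f‖ := fun p => f.norm_coe_le_norm p.1
    have := hL.apply_eq_integral hπ ⟨fun p => f p.1, by fun_prop⟩ hb
      (mem_quadGrowth_of_abs_le _ hb)
    rw [hL.apply_add _ f 0 (f.integrable μ) (integrable_zero _ _ _) (by simp)] at this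
    rw [Measure.fst, integral_map measurable_fst.aemeasurable
      f.continuous.aestronglyMeasurable]
    simpa using this.symm
  · refine ext_of_forall_integral_eq_of_IsFiniteMeasure fun f => ?_
    have hb : ∀ p : Sp D × Sp D, |f p.2| ≤ ‖f‖ := fun p => f.norm_coe_le_norm p.2
    have := hL.apply_eq_integral hπ ⟨fun p => f p.2, by fun_prop⟩ hb
      (mem_quadGrowth_of_abs_le _ hb)
    rw [hL.apply_add _ 0 f (integrable_zero _ _ _) (f.integrable ν) (by simp)] at this
    rw [Measure.snd, integral_map measurable_snd.aemeasurable
      f.continuous.aestronglyMeasurable]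
    simpa using this.symm

end IsCouplingFunctional

/-! ### Integrals with extended real values -/

section ExtIntegral

variable {D : ℕ} {μ : Measure (Sp D)}

theorem extIntegral_mono_ae {f g : Sp D → EReal} (h : ∀ᵐ x ∂μ, f x ≤ g x) :
    extIntegral μ f ≤ extIntegral μ g := by
  refine EReal.sub_le_sub ?_ ?_ <;> rw [EReal.coe_ennreal_le_coe_ennreal_iff]
  · exact lintegral_mono_ae (h.mono fun x hx => EReal.toENNReal_le_toENNReal hx)
  · exact lintegral_mono_ae (h.mono fun x hx =>
      EReal.toENNReal_le_toENNReal (EReal.neg_le_neg_iff.2 hx))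

theorem extIntegral_congr_ae {f g : Sp D → EReal} (h : ∀ᵐ x ∂μ, f x = g x) :
    extIntegral μ f = extIntegral μ g :=
  le_antisymm (extIntegral_mono_ae (h.mono fun _ hx => hx.le))
    (extIntegral_mono_ae (h.mono fun _ hx => hx.ge))

theorem extIntegral_coe {f : Sp D → ℝ} (hf : Integrable f μ) :
    extIntegral μ (fun x => (f x : EReal)) = ((∫ x, f x ∂μ : ℝ) : EReal) := by
  have h1 : ∫⁻ x, ENNReal.ofReal (f x) ∂μ ≠ ⊤ := hf.lintegral_lt_top.ne
  have h2 : ∫⁻ x, ENNReal.ofReal (-f x) ∂μ ≠ ⊤ := hf.neg.lintegral_lt_top.ne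
  rw [integral_eq_lintegral_pos_part_sub_lintegral_neg_part hf, EReal.coe_sub,
    EReal.coe_ennreal_toReal h1, EReal.coe_ennreal_toReal h2]
  rfl

/-- A function below an integrable one with the same integral is almost everywhere equal to it. -/
theorem ae_eq_of_integral_le_extIntegral {f : Sp D → EReal} (hf : Measurable f) {g : Sp D → ℝ}
    (hg : Integrable g μ) (hfg : ∀ x, f x ≤ g x)
    (h : ((∫ x, g x ∂μ : ℝ) : EReal) ≤ extIntegral μ f) : ∀ᵐ x ∂μ, f x = g x := by
  have hP : ∫⁻ x, (f x).toENNReal ∂μ ≠ ⊤ :=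
    ((lintegral_mono fun x => EReal.toENNReal_le_toENNReal (hfg x)).trans_lt
      hg.lintegral_lt_top).ne
  -- An infinite negative part would make the extended integral `⊥`, which is below the real number
  -- `∫ g`.
  have hN : ∫⁻ x, (-f x).toENNReal ∂μ ≠ ⊤ := by
    intro hN
    rw [extIntegral, hN, EReal.coe_ennreal_top, EReal.sub_top] at h
    exact EReal.coe_ne_bot _ (le_bot_iff.1 h)
  have hcoe : ∀ᵐ x ∂μ, f x = ((f x).toReal : EReal) := by
    filter_upwards [ae_lt_top hf.neg.ereal_toENNReal hN] with x hx
    refine (EReal.coe_toReal (ne_top_of_le_ne_top (EReal.coe_ne_top _) (hfg x)) ?_).symm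
    intro hbot
    simp [hbot] at hx
  have hle : (fun x => (f x).toReal) ≤ᵐ[μ] g := by
    filter_upwards [hcoe] with x hx
    have := hfg x
    rw [hx] at this
    exact_mod_cast this
  have hint : Integrable (fun x => (f x).toReal) μ := by
    refine ⟨hf.ereal_toReal.aestronglyMeasurable, ?_⟩
    have : ∫⁻ x, ‖(f x).toReal‖ₑ ∂μ ≤
        ∫⁻ x, ((f x).toENNReal + (-f x).toENNReal) ∂μ := by
      refine lintegral_mono_ae ?_
      filter_upwards [hcoe] with x hx
      conv_rhs => rw [hx, ← EReal.coe_neg]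
      rw [EReal.real_coe_toENNReal, EReal.real_coe_toENNReal, Real.enorm_eq_ofReal_abs]
      rcases le_total 0 (f x).toReal with h0 | h0
      · rw [abs_of_nonneg h0]
        exact le_self_add
      · rw [abs_of_nonpos h0]
        exact le_add_self
    rw [lintegral_add_left hf.ereal_toENNReal] at this
    exact this.trans_lt (ENNReal.add_lt_top.2 ⟨hP.lt_top, hN.lt_top⟩)
  rw [extIntegral_congr_ae hcoe, extIntegral_coe hint, EReal.coe_le_coe_iff] at h
  have := (integral_eq_iff_of_ae_le hint hg hle).1 (le_antisymm (integral_mono_ae hint hg hle) h)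
  filter_upwards [hcoe, this] with x hx hx'
  rw [hx, hx']

end ExtIntegral

/-! ### Kantorovich duality -/

section Duality

variable {D : ℕ} {μ ν : Measure (Sp D)}

theorem continuous_quadCost : Continuous (fun p : Sp D × Sp D => quadCost p.1 p.2) := by
  unfold quadCost
  fun_prop

theorem planCost_mapPlan {T : Sp D → Sp D} (hT : Measurable T) :
    planCost (mapPlan μ T) = mapCost μ T :=
  lintegral_map continuous_quadCost.measurable.ennreal_ofReal (measurable_id.prodMk hT)

theorem IsTransportMap.of_isCoupling_mapPlan {T : Sp D → Sp D} (hT : Measurable T)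
    (h : IsCoupling μ ν (mapPlan μ T)) : IsTransportMap μ ν T :=
  ⟨hT, by rw [← h.2, mapPlan, Measure.snd_map_prodMk measurable_id']⟩

theorem cTransform_le (v : Sp D → ℝ) (x y : Sp D) :
    cTransform v x ≤ ((quadCost x y - v y : ℝ) : EReal) :=
  iInf_le _ y

theorem measurable_cTransform (v : Sp D → ℝ) : Measurable (cTransform v) := by
  have hy : ∀ y, Continuous fun x => ((quadCost x y - v y : ℝ) : EReal) := fun y =>
    continuous_coe_real_ereal.comp
      ((continuous_quadCost.comp (continuous_id.prodMk continuous_const)).sub continuous_const)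
  have : UpperSemicontinuous fun x => ⨅ y, ((quadCost x y - v y : ℝ) : EReal) :=
    upperSemicontinuous_iInf fun y => (hy y).upperSemicontinuous
  exact this.measurable

theorem neg_quadCost_mem_quadGrowth (D : ℕ) :
    (fun p : Sp D × Sp D => -quadCost p.1 p.2) ∈ quadGrowth D :=
  neg_mem (quadCost_mem_quadGrowth D)

/-- If `-c ≤ a ⊕ b`, then `w = -b` is a dual competitor with `w^c ≥ -a`, hence with dual objective
at least `-∫ a - ∫ b`. -/
theorem IsDualMaximizer.neg_splitInf_le [IsProbabilityMeasure μ]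
    (hμ : FiniteSecondMoment μ) (hν : FiniteSecondMoment ν) {v : Sp D → ℝ} (hv : IsDualMaximizer μ ν v) :
    ((-splitInf μ ν (fun p => -quadCost p.1 p.2) : ℝ) : EReal) ≤ dualObjective μ ν v := by
  by_contra! hlt
  obtain ⟨t, ht, ht'⟩ := EReal.lt_iff_exists_real_btwn.1 hlt
  rw [EReal.coe_lt_coe_iff, lt_neg] at ht'
  obtain ⟨_, ⟨a, b, ha, hb, hab, rfl⟩, hr⟩ := exists_lt_of_csInf_lt
    (splitBounds_nonempty hμ hν (neg_quadCost_mem_quadGrowth D)) ht'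
  refine (ht.trans_le ?_).not_ge (hv.2 (-b) hb.neg)
  have h1 : ((∫ x, -a x ∂μ : ℝ) : EReal) ≤ extIntegral μ (cTransform (-b)) := by
    rw [← extIntegral_coe ha.fun_neg]
    refine extIntegral_mono_ae (ae_of_all _ fun x => le_iInf fun y => ?_)
    rw [EReal.coe_le_coe_iff, Pi.neg_apply]
    linarith [hab x y]
  refine le_trans ?_ (add_le_add_left h1 _)
  rw [← EReal.coe_add, EReal.coe_le_coe_iff]
  simp only [Pi.neg_apply, integral_neg]
  linarith

variable [IsProbabilityMeasure μ] [IsProbabilityMeasure ν]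

/-- The Kantorovich inequality: some coupling costs at most the value of the dual problem. -/
theorem exists_isCoupling_planCost_le (hμ : FiniteSecondMoment μ) (hν : FiniteSecondMoment ν) :
    ∃ π : Measure (Sp D × Sp D), IsCoupling μ ν π ∧
      planCost π ≤ ENNReal.ofReal (-splitInf μ ν (fun p => -quadCost p.1 p.2)) := by
  obtain ⟨L, hL, hLc⟩ := exists_coupling_functional hμ hν
  obtain ⟨π, hfin, hπ⟩ := hL.exists_measure
  refine ⟨π, hL.isCoupling hπ, ?_⟩
  rw [← hLc]
  exact hL.lintegral_le hπ continuous_quadCost (fun p => quadCost_nonneg _ _) _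

theorem splitInf_neg_quadCost_nonpos (hμ : FiniteSecondMoment μ) (hν : FiniteSecondMoment ν) :
    splitInf μ ν (fun p => -quadCost p.1 p.2) ≤ 0 := by
  simpa using splitInf_le hμ hν (neg_quadCost_mem_quadGrowth D) (integrable_zero _ _ _)
    (integrable_zero _ _ _) (fun x y => by simpa using quadCost_nonneg x y)

end Duality

/-! ### Complementary slackness -/

section Map

variable {D : ℕ} {μ ν : Measure (Sp D)}

theorem IsTransportMap.integrable_quadCost [IsFiniteMeasure μ] (hμ : FiniteSecondMoment μ)
    (hν : FiniteSecondMoment ν) {T : Sp D → Sp D} (hT : IsTransportMap μ ν T) :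
    Integrable (fun x => quadCost x (T x)) μ := by
  have hTν : Integrable (fun x => ‖T x‖ ^ 2) μ := by
    have : Integrable (fun y : Sp D => ‖y‖ ^ 2) (μ.map T) := hT.2 ▸ hν
    exact this.comp_measurable hT.1
  refine (hμ.add hTν).mono' (continuous_quadCost.measurable.comp
    (measurable_id.prodMk hT.1)).aestronglyMeasurable (ae_of_all _ fun x => ?_)
  rw [Real.norm_eq_abs, abs_of_nonneg (quadCost_nonneg _ _)]
  exact quadCost_le _ _

variable [IsProbabilityMeasure μ] [IsProbabilityMeasure ν]

/-- Complementary slackness for an optimal map and a maximizer of the dual problem. -/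
theorem IsDualMaximizer.cTransform_ae_eq (hμ : FiniteSecondMoment μ) (hν : FiniteSecondMoment ν)
    {S : Sp D → Sp D} (hS : Measurable S) (hSopt : IsOTPlan μ ν (mapPlan μ S))
    {T : Sp D → Sp D} (hT : IsOTMap μ ν T) {v : Sp D → ℝ} (hv : IsDualMaximizer μ ν v) :
    ∀ᵐ x ∂μ, cTransform v x = ((quadCost x (T x) - v (T x) : ℝ) : EReal) := by
  have hc := hT.1.integrable_quadCost hμ hν
  have hvν : Integrable v (μ.map T) := hT.1.2 ▸ hv.1
  have hvT : Integrable (fun x => v (T x)) μ := hvν.comp_measurable hT.1.1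
  refine ae_eq_of_integral_le_extIntegral (measurable_cTransform v) (hc.sub hvT)
    (fun x => cTransform_le v x (T x)) ?_
  obtain ⟨π, hπ, hπc⟩ := exists_isCoupling_planCost_le hμ hν
  have hcost : ∫ x, quadCost x (T x) ∂μ ≤ -splitInf μ ν (fun p => -quadCost p.1 p.2) := by
    rw [← ENNReal.ofReal_le_ofReal_iff (neg_nonneg.2 (splitInf_neg_quadCost_nonpos hμ hν)),
      ofReal_integral_eq_lintegral_ofReal hc (ae_of_all _ fun x => quadCost_nonneg _ _)]
    -- `T*` is optimal only among maps; the map `S`, whose plan is optimal among all couplings,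
    -- links it to `π`.
    refine le_trans (hT.2 S (.of_isCoupling_mapPlan hS hSopt.1)) ?_
    rw [← planCost_mapPlan hS]
    exact (hSopt.2 π hπ).trans hπc
  have hdual := (EReal.coe_le_coe_iff.2 hcost).trans (hv.neg_splitInf_le hμ hν)
  have hvint : ∫ x, v (T x) ∂μ = ∫ y, v y ∂ν := by
    rw [← integral_map hT.1.1.aemeasurable hvν.aestronglyMeasurable, hT.1.2]
  have hsub : ∫ x, (quadCost x (T x) - v (T x)) ∂μ =
      ∫ x, quadCost x (T x) ∂μ - ∫ y, v y ∂ν := by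
    rw [integral_sub hc hvT, hvint]
  rw [hsub, EReal.coe_sub]
  exact EReal.sub_le_of_le_add hdual

end Map

theorem inner_sub_sq_div_two {D : ℕ} (v : Sp D → ℝ) (x y : Sp D) :
    ⟪x, y⟫ - (‖y‖ ^ 2 / 2 - v y) = ‖x‖ ^ 2 / 2 - (quadCost x y - v y) := by
  rw [quadCost, norm_sub_sq_real]
  ring

end OT

theorem lemma4p1 (D : ℕ) (μ ν : MeasureTheory.Measure (OT.Sp D))
    [MeasureTheory.IsProbabilityMeasure μ] [MeasureTheory.IsProbabilityMeasure ν]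
    (hμ : OT.FiniteSecondMoment μ) (hν : OT.FiniteSecondMoment ν)
    (hdet : ∃ S : OT.Sp D → OT.Sp D, Measurable S ∧ OT.IsOTPlan μ ν (OT.mapPlan μ S))
    (Tstar : OT.Sp D → OT.Sp D) (hT : OT.IsOTMap μ ν Tstar)
    (ψ : OT.Sp D → ℝ) (hψ : OT.IsOptimalPotential μ ν ψ) :
    MeasureTheory.Integrable (fun x => inner ℝ x (Tstar x) - ψ (Tstar x)) μ ∧
    (∀ T : OT.Sp D → OT.Sp D, OT.mapObjective μ ψ T ≤ OT.mapObjective μ ψ Tstar) ∧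
    (∀ᵐ x ∂μ, ((inner ℝ x (Tstar x) - ψ (Tstar x) : ℝ) : EReal) = OT.conjugate ψ x) := by
  obtain ⟨S, hS, hSopt⟩ := hdet
  obtain ⟨v, hv, hψv⟩ := hψ
  have hval : ∀ x y, inner ℝ x y - ψ y = ‖x‖ ^ 2 / 2 - (OT.quadCost x y - v y) := fun x y => by
    rw [hψv, OT.inner_sub_sq_div_two]
  have hconj : ∀ᵐ x ∂μ,
      ((inner ℝ x (Tstar x) - ψ (Tstar x) : ℝ) : EReal) = OT.conjugate ψ x := by
    filter_upwards [hv.cTransform_ae_eq hμ hν hS hSopt hT] with x hx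
    refine le_antisymm (le_iSup (fun y => ((inner ℝ x y - ψ y : ℝ) : EReal)) (Tstar x))
      (iSup_le fun y => ?_)
    have := OT.cTransform_le v x y
    rw [hx, EReal.coe_le_coe_iff] at this
    rw [EReal.coe_le_coe_iff, hval, hval]
    linarith
  -- The integrand at `T x` is at most the conjugate, which is the integrand at `T* x`; monotonicity
  -- of the extended integral needs no measurability of `T`.
  refine ⟨?_, fun T => OT.extIntegral_mono_ae ?_, hconj⟩
  · simp only [hval]
    have hvν : MeasureTheory.Integrable v (μ.map Tstar) := hT.1.2 ▸ hv.1
    exact (hμ.div_const 2).sub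
      ((hT.1.integrable_quadCost hμ hν).sub (hvν.comp_measurable hT.1.1))
  · filter_upwards [hconj] with x hx
    rw [hx]
    exact le_iSup (fun y => ((inner ℝ x y - ψ y : ℝ) : EReal)) (T x)
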